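/- Let $\mathcal H$ be a finite-dimensional complex Hilbert space, let $\tau_1,\dots,\tau_M$ be density operators on $\mathcal H$ (self-adjoint, positive semidefinite, unit trace), and let $p_1,\dots,p_M\ge 0$ with $\sum_{i=1}^M p_i=1$. An $M$-ary test is a POVM $\mathcal P=\{\Pi_1,\dots,\Pi_M\}$, i.e. positive semidefinite operators on $\mathcal H$ with $\sum_i\Pi_i=\mathbb 1$; its average error probability is $\epsilon(\mathcal P)=1-\sum_{i=1}^M p_i\,\mathrm{tr}(\tau_i\Pi_i)$. For density operators $\rho_0,\rho_1$ on a finite-dimensional complex Hilbert space and $\beta\ge 0$ let $$\alpha_\beta(\rho_0\,\|\,\rho_1)=\inf\bigl\{1-\mathrm{tr}(\rho_0T)\;:\;0\le T\le\mathbb 1,\ \mathrm{tr}(\rho_1T)\le\beta\bigr\}.$$ On the direct sum of $M$ copies of $\mathcal H$ define the block-diagonal density operators $\mathcal T=\mathrm{diag}(p_1\tau_1,\dots,p_M\tau_M)$ and, for a density operator $\mu_0$ on $\mathcal H$, $\mathcal D(\mu_0)=\mathrm{diag}\bigl(\tfrac1M\mu_0,\dots,\tfrac1M\mu_0\bigr)$.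 Then the minimum $\epsilon^\star=\min_{\mathcal P}\epsilon(\mathcal P)$ over all $M$-ary tests exists, and $$\epsilon^\star=\max_{\mu_0}\,\alpha_{1/M}\bigl(\mathcal T\,\|\,\mathcal D(\mu_0)\bigr),$$ where the maximum is over all density operators $\mu_0$ on $\mathcal H$ and is attained. -/

import Mathlib

/- Operators on a finite-dimensional complex Hilbert space `H` are the linear maps `H →ₗ[ℂ] H`;
`LinearMap.IsPositive` means self-adjoint and positive semidefinite. -/

namespace QHT

noncomputable section

variable {H : Type*} [NormedAddCommGroup H] [InnerProductSpace ℂ H] {M : ℕ}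

/-- Density operators: self-adjoint, positive semidefinite, of unit trace. -/
def IsDensityOperator (ρ : H →ₗ[ℂ] H) : Prop :=
  ρ.IsPositive ∧ LinearMap.trace ℂ H ρ = 1

/-- `T` defines a binary test `{T, 1 - T}`, with `T` and `1 - T` positive semidefinite.
The outcome `T` decides the hypothesis `ρ₀`. -/
def IsBinaryTest (T : H →ₗ[ℂ] H) : Prop :=
  T.IsPositive ∧ (1 - T).IsPositive

/-- Probability `1 - tr (ρ₀ T)` of deciding `ρ₁` when `ρ₀` is true. -/
def typeIError (ρ₀ T : H →ₗ[ℂ] H) : ℝ :=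
  1 - (LinearMap.trace ℂ H (ρ₀ ∘ₗ T)).re

/-- Probability `tr (ρ₁ T)` of deciding `ρ₀` when `ρ₁` is true. -/
def typeIIError (ρ₁ T : H →ₗ[ℂ] H) : ℝ :=
  (LinearMap.trace ℂ H (ρ₁ ∘ₗ T)).re

/-- `α_β(ρ₀ ‖ ρ₁)`: the infimum of the type-I error over all binary tests whose type-II error
is at most `β`. -/
def alpha (β : ℝ) (ρ₀ ρ₁ : H →ₗ[ℂ] H) : ℝ :=
  sInf {e : ℝ | ∃ T : H →ₗ[ℂ] H, IsBinaryTest T ∧ typeIIError ρ₁ T ≤ β ∧ typeIError ρ₀ T = e}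

/-- An `M`-ary test: a POVM with `M` outcomes. -/
def IsPOVM (P : Fin M → (H →ₗ[ℂ] H)) : Prop :=
  (∀ i, (P i).IsPositive) ∧ ∑ i, P i = 1

/-- Average error probability `1 - ∑ i, p i * tr (τ i * P i)` of the test `P`. -/
def avgError (p : Fin M → ℝ) (τ P : Fin M → (H →ₗ[ℂ] H)) : ℝ :=
  1 - ∑ i, p i * (LinearMap.trace ℂ H (τ i ∘ₗ P i)).re

/-- The average error probabilities achieved by `M`-ary tests. -/
def achievableErrors (p : Fin M → ℝ) (τ : Fin M → (H →ₗ[ℂ] H)) : Set ℝ :=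
  {e : ℝ | ∃ P : Fin M → (H →ₗ[ℂ] H), IsPOVM P ∧ avgError p τ P = e}

/-- The minimum average error probability `ε*`. -/
def minError (p : Fin M → ℝ) (τ : Fin M → (H →ₗ[ℂ] H)) : ℝ :=
  sInf (achievableErrors p τ)

/-- The block-diagonal operator `diag (A 1, …, A M)` on the Hilbert direct sum of `M` copies
of `H`. -/
def blockDiag (A : Fin M → (H →ₗ[ℂ] H)) :
    PiLp 2 (fun _ : Fin M => H) →ₗ[ℂ] PiLp 2 (fun _ : Fin M => H) where
  toFun x := WithLp.toLp 2 (fun i => A i (x i))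
  map_add' x y := by ext i; simp
  map_smul' c x := by ext i; simp

/-- `𝒯 = diag (p 1 τ 1, …, p M τ M)`. -/
def bigT (p : Fin M → ℝ) (τ : Fin M → (H →ₗ[ℂ] H)) :
    PiLp 2 (fun _ : Fin M => H) →ₗ[ℂ] PiLp 2 (fun _ : Fin M => H) :=
  blockDiag (fun i => (p i : ℂ) • τ i)

/-- `𝒟(μ) = diag (μ / M, …, μ / M)`, with `M` blocks. -/
def bigD (M : ℕ) (μ : H →ₗ[ℂ] H) :
    PiLp 2 (fun _ : Fin M => H) →ₗ[ℂ] PiLp 2 (fun _ : Fin M => H) :=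
  blockDiag (fun _ : Fin M => (1 / (M : ℂ)) • μ)

end

end QHT

namespace QHT

/-! ### Perturbed measurements, the optimality operator, and compactness of the set of POVMs. -/

section Operators

variable {H : Type*} [NormedAddCommGroup H] [InnerProductSpace ℂ H]

/-! Write `A i = p i • τ i`. Upper bound: a POVM `P` gives the binary test `blockDiag P`, whose
type-I error is `avgError p τ P` and whose type-II error is exactly `1 / M` for every `μ`, so no
`alpha` exceeds the minimum error. Attainment: by compactness an optimal `P` exists, with success
probability `s`. First-order optimality shows that `Λ = ½ ∑ (A i * P i + P i * A i)` dominates every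
`A j` and has trace `s` (`exists_dominating_operator`). With `μ = Λ / s` this reads `bigT ≤ s M •
bigD M μ`, so a test of type-II error at most `1 / M` succeeds on `bigT` with probability at most
`s` (`one_sub_le_typeIError`). -/

theorem IsPOVM.isPositive_one_sub {M : ℕ} {P : Fin M → (H →ₗ[ℂ] H)} (hP : IsPOVM P) (i : Fin M) :
    (1 - P i).IsPositive := by
  rw [← hP.2, ← Finset.add_sum_erase _ P (Finset.mem_univ i), add_sub_cancel_left]
  exact LinearMap.isPositive_sum _ fun j _ => hP.1 j

theorem isPositive_of_unit_vectors {G : H →ₗ[ℂ] H} (hG : G.IsSymmetric)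
    (h : ∀ v : H, ‖v‖ = 1 → 0 ≤ (inner ℂ v (G v)).re) : G.IsPositive := by
  refine ⟨hG, fun v => ?_⟩
  rcases eq_or_ne v 0 with rfl | hv
  · simp
  have hu : ‖((‖v‖⁻¹ : ℝ) : ℂ) • v‖ = 1 := by
    rw [norm_smul]; simp [hv]
  have key := h _ hu
  rw [map_smul, inner_smul_left, inner_smul_right, ← mul_assoc, Complex.conj_ofReal,
    ← Complex.ofReal_mul, Complex.re_ofReal_mul] at key
  have hpos : 0 < ‖v‖⁻¹ * ‖v‖⁻¹ := by positivity
  rw [hG v v]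
  exact nonneg_of_mul_nonneg_right key hpos

theorem achievableErrors_nonempty {M : ℕ} [NeZero M] (p : Fin M → ℝ) (τ : Fin M → (H →ₗ[ℂ] H)) :
    (achievableErrors p τ).Nonempty := by
  refine ⟨_, fun i => if i = 0 then 1 else 0, ⟨fun i => ?_, by simp⟩, rfl⟩
  dsimp only
  split_ifs
  exacts [LinearMap.isPositive_one, LinearMap.isPositive_zero]

theorem isBinaryTest_zero : IsBinaryTest (0 : H →ₗ[ℂ] H) :=
  ⟨LinearMap.isPositive_zero, by simp⟩

/-- A symmetric perturbation of a POVM moving weight along a projection `L` to the outcome `j`. -/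
def perturb {M : ℕ} (P : Fin M → (H →ₗ[ℂ] H)) (L : H →ₗ[ℂ] H) (j : Fin M) (t : ℝ) (i : Fin M) :
    H →ₗ[ℂ] H :=
  (1 - (t : ℂ) • L) * P i * (1 - (t : ℂ) • L) +
    if i = j then ((t * (2 - t) : ℝ) : ℂ) • L else 0

/-- The expansion in `t` is exact; optimality will force the linear coefficient to be nonpositive.
-/
theorem re_trace_perturb {M : ℕ} (P A : Fin M → (H →ₗ[ℂ] H)) (L : H →ₗ[ℂ] H) (j : Fin M) (t : ℝ) :
    ∑ i, (LinearMap.trace ℂ H (A i * perturb P L j t i)).re =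
      ∑ i, (LinearMap.trace ℂ H (A i * P i)).re +
      t * (2 * (LinearMap.trace ℂ H (A j * L)).re -
        (LinearMap.trace ℂ H ((∑ i, (A i * P i + P i * A i)) * L)).re) +
      t ^ 2 * (∑ i, (LinearMap.trace ℂ H (A i * (L * P i * L))).re -
        (LinearMap.trace ℂ H (A j * L)).re) := by
  have h : ∀ i, (LinearMap.trace ℂ H (A i * perturb P L j t i)).re =
      (LinearMap.trace ℂ H (A i * P i)).re -
        t * (LinearMap.trace ℂ H ((A i * P i + P i * A i) * L)).re +
        t ^ 2 * (LinearMap.trace ℂ H (A i * (L * P i * L))).re +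
        if i = j then t * (2 - t) * (LinearMap.trace ℂ H (A i * L)).re else 0 := by
    intro i
    have e : A i * perturb P L j t i = A i * P i - (t : ℂ) • (A i * L * P i) -
        (t : ℂ) • (A i * P i * L) + ((t ^ 2 : ℝ) : ℂ) • (A i * (L * P i * L)) +
        if i = j then ((t * (2 - t) : ℝ) : ℂ) • (A i * L) else 0 := by
      rw [perturb]
      split_ifs <;>
      · simp only [mul_add, mul_sub, sub_mul, one_mul, mul_one, smul_mul_assoc, mul_smul_comm,
          mul_assoc, mul_zero]
        push_cast
        module
    -- Cyclicity moves `L` to the right, so the two first-order terms merge into an anticommutator.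
    have e2 : LinearMap.trace ℂ H (A i * L * P i) = LinearMap.trace ℂ H (P i * A i * L) := by
      rw [LinearMap.trace_mul_comm, mul_assoc]
    rw [e, add_mul]
    split_ifs <;>
    · simp only [map_add, map_sub, map_smul, smul_eq_mul, Complex.add_re, Complex.sub_re,
        Complex.re_ofReal_mul, e2, map_zero, Complex.zero_re]
      ring
  rw [Finset.sum_mul, map_sum, Complex.re_sum]
  simp only [h, Finset.sum_add_distrib, Finset.sum_sub_distrib, ← Finset.mul_sum,
    Finset.sum_ite_eq', Finset.mem_univ, if_true]
  ring

variable [FiniteDimensional ℂ H]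

/-- In an eigenbasis of `B`, the trace is a sum of eigenvalues of `B` times diagonal entries of `A`.
-/
theorem re_trace_comp_nonneg {A B : H →ₗ[ℂ] H} (hA : A.IsPositive) (hB : B.IsPositive) :
    0 ≤ (LinearMap.trace ℂ H (A ∘ₗ B)).re := by
  let b := hB.isSymmetric.eigenvectorBasis rfl
  rw [LinearMap.trace_eq_sum_inner _ b, Complex.re_sum]
  refine Finset.sum_nonneg fun i _ => ?_
  have h : B (b i) = ((hB.isSymmetric.eigenvalues rfl i : ℝ) : ℂ) • b i :=
    hB.isSymmetric.apply_eigenvectorBasis rfl i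
  rw [LinearMap.comp_apply, h, map_smul, inner_smul_right, Complex.re_ofReal_mul]
  exact mul_nonneg (hB.nonneg_eigenvalues rfl i) (hA.re_inner_nonneg_right (b i))

theorem le_of_forall_quadratic_le {f a b c : ℝ}
    (h : ∀ t : ℝ, 0 < t → t ≤ 1 → f + t * (a - b) + t ^ 2 * c ≤ f) : a ≤ b := by
  by_contra! hab
  have hd : 0 < a - b := sub_pos.2 hab
  have h0 : 0 < a - b + |c| := by positivity
  -- This `t` makes `t * |c| ≤ (a - b) / 2`, so the linear term beats the quadratic one.
  set t := (a - b) / (2 * (a - b + |c|)) with ht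
  have ht0 : 0 < t := by positivity
  have ht1 : t ≤ 1 := by
    rw [ht, div_le_one (by positivity)]
    linarith [abs_nonneg c]
  have h1 := h t ht0 ht1
  have h2 : (a - b) + t * c ≤ 0 := by
    by_contra! h3
    nlinarith [mul_pos ht0 h3]
  have h4 : t * (a - b + |c|) = (a - b) / 2 := by
    rw [ht]; field_simp
  have h5 : t * (-|c|) ≤ t * c := mul_le_mul_of_nonneg_left (neg_abs_le c) ht0.le
  nlinarith [mul_pos ht0 hd]

/-- Since `L * L = L`, the square of `1 - t • L` is `1 - t(2 - t) • L`; the extra term at `j`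
restores the sum. -/
theorem isPOVM_perturb {M : ℕ} {P : Fin M → (H →ₗ[ℂ] H)} (hP : IsPOVM P) {L : H →ₗ[ℂ] H}
    (hL : L.IsPositive) (hLL : L * L = L) (j : Fin M) {t : ℝ} (ht : 0 ≤ t) (ht1 : t ≤ 1) :
    IsPOVM (perturb P L j t) := by
  have hX : LinearMap.adjoint (1 - (t : ℂ) • L) = 1 - (t : ℂ) • L := by
    rw [map_sub, LinearMap.adjoint_one, map_smulₛₗ, hL.adjoint_eq, Complex.conj_ofReal]
  refine ⟨fun i => ?_, ?_⟩
  · refine LinearMap.IsPositive.add ?_ ?_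
    · have := (hP.1 i).conj_adjoint (1 - (t : ℂ) • L)
      rw [hX] at this
      exact this
    · split_ifs
      · refine hL.smul_of_nonneg ?_
        exact_mod_cast mul_nonneg ht (by linarith)
      · exact LinearMap.isPositive_zero
  · simp only [perturb]
    rw [Finset.sum_add_distrib, ← Finset.sum_mul, ← Finset.mul_sum, hP.2]
    simp only [Finset.sum_ite_eq', Finset.mem_univ, if_true, mul_one, mul_sub, sub_mul, one_mul,
      hLL, mul_smul_comm, smul_mul_assoc]
    push_cast
    module

/-- Optimality of a POVM yields an operator dominating all weighted states with trace equal to the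
success probability. -/
theorem exists_dominating_operator {M : ℕ} {P A : Fin M → (H →ₗ[ℂ] H)} (hP : IsPOVM P)
    (hA : ∀ i, (A i).IsPositive)
    (hopt : ∀ Q, IsPOVM Q → ∑ i, (LinearMap.trace ℂ H (A i * Q i)).re ≤
      ∑ i, (LinearMap.trace ℂ H (A i * P i)).re) :
    ∃ Λ : H →ₗ[ℂ] H, (∀ j, (Λ - A j).IsPositive) ∧
      (LinearMap.trace ℂ H Λ).re = ∑ i, (LinearMap.trace ℂ H (A i * P i)).re := by
  set S := ∑ i, (A i * P i + P i * A i) with hS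
  have hSs : S.IsSymmetric := by
    intro x y
    simp only [hS, LinearMap.sum_apply, LinearMap.add_apply, Module.End.mul_apply, sum_inner,
      inner_sum, inner_add_left, inner_add_right]
    refine Finset.sum_congr rfl fun i _ => ?_
    rw [(hA i).isSymmetric, (hP.1 i).isSymmetric, (hP.1 i).isSymmetric, (hA i).isSymmetric,
      add_comm]
  refine ⟨((1 / 2 : ℝ) : ℂ) • S, fun j => ?_, ?_⟩
  · refine isPositive_of_unit_vectors ?_ fun v hv => ?_
    · intro x y
      simp only [LinearMap.sub_apply, LinearMap.smul_apply, inner_sub_left, inner_sub_right,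
        inner_smul_left, inner_smul_right, Complex.conj_ofReal, hSs x y, (hA j).isSymmetric x y]
    · let L : H →ₗ[ℂ] H := (InnerProductSpace.rankOne ℂ v v : H →L[ℂ] H)
      have hLa : ∀ x, L x = inner ℂ v x • v := fun x => by simp [L]
      have hL : L.IsPositive := (InnerProductSpace.isPositive_rankOne_self v).toLinearMap
      have hLL : L * L = L := by
        ext x
        simp [Module.End.mul_apply, hLa, inner_self_eq_norm_sq_to_K, hv]
      have htr : ∀ G : H →ₗ[ℂ] H, LinearMap.trace ℂ H (G * L) = inner ℂ v (G v) := fun G => by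
        have : G * L = (InnerProductSpace.rankOne ℂ (G v) v : H →L[ℂ] H) := by
          ext x
          simp [Module.End.mul_apply, hLa]
        rw [this, InnerProductSpace.trace_rankOne]
      have key : 2 * (LinearMap.trace ℂ H (A j * L)).re ≤ (LinearMap.trace ℂ H (S * L)).re := by
        refine le_of_forall_quadratic_le
          (f := ∑ i, (LinearMap.trace ℂ H (A i * P i)).re)
          (c := ∑ i, (LinearMap.trace ℂ H (A i * (L * P i * L))).re -
            (LinearMap.trace ℂ H (A j * L)).re) fun t ht ht1 => ?_
        rw [← re_trace_perturb]
        exact hopt _ (isPOVM_perturb hP hL hLL j ht.le ht1)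
      rw [htr, htr] at key
      rw [LinearMap.sub_apply, LinearMap.smul_apply, inner_sub_right, inner_smul_right,
        Complex.sub_re, Complex.re_ofReal_mul]
      linarith
  · rw [map_smul, smul_eq_mul, Complex.re_ofReal_mul, hS, map_sum, Complex.re_sum, Finset.mul_sum]
    refine Finset.sum_congr rfl fun i _ => ?_
    rw [map_add, LinearMap.trace_mul_comm ℂ (P i), Complex.add_re]
    ring

theorem isCompact_setOf_isPOVM (M : ℕ) :
    IsCompact {P : Fin M → (H →L[ℂ] H) | IsPOVM fun i => (P i : H →ₗ[ℂ] H)} := by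
  have : ProperSpace (Fin M → (H →L[ℂ] H)) := FiniteDimensional.proper ℂ _
  refine Metric.isCompact_of_isClosed_isBounded ?_ ?_
  · have : {P : Fin M → (H →L[ℂ] H) | IsPOVM fun i => (P i : H →ₗ[ℂ] H)} =
        (⋂ i, {P | 0 ≤ P i}) ∩ {P | ∑ i, P i = 1} := by
      ext P
      simp only [IsPOVM, Set.mem_ofPred_eq, Set.mem_inter_iff, Set.mem_iInter,
        ContinuousLinearMap.nonneg_iff_isPositive, ContinuousLinearMap.isPositive_toLinearMap_iff]
      refine and_congr_right fun _ => ?_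
      rw [← ContinuousLinearMap.coe_inj]
      simp [Module.End.one_eq_id]
    rw [this]
    refine (isClosed_iInter fun i => ?_).inter ?_
    · exact isClosed_le continuous_const (continuous_apply i)
    · exact isClosed_eq (by fun_prop) continuous_const
  · refine (Metric.isBounded_iff_subset_closedBall 0).2
      ⟨‖(1 : H →L[ℂ] H)‖, fun P hP => mem_closedBall_zero_iff.2 ?_⟩
    refine (pi_norm_le_iff_of_nonneg (norm_nonneg _)).2 fun i => ?_
    -- Boundedness comes from `0 ≤ P i ≤ 1`.
    refine CStarAlgebra.norm_le_norm_of_nonneg_of_le ?_ ?_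
    · rw [ContinuousLinearMap.nonneg_iff_isPositive, ← ContinuousLinearMap.isPositive_toLinearMap_iff]
      exact hP.1 i
    · rw [ContinuousLinearMap.le_def, ← ContinuousLinearMap.isPositive_toLinearMap_iff]
      exact IsPOVM.isPositive_one_sub hP i

theorem isCompact_achievableErrors {M : ℕ} (p : Fin M → ℝ) (τ : Fin M → (H →ₗ[ℂ] H)) :
    IsCompact (achievableErrors p τ) := by
  let F : (Fin M → (H →L[ℂ] H)) → ℝ := fun P => avgError p τ fun i => (P i : H →ₗ[ℂ] H)
  have hF : Continuous F := by
    refine continuous_const.sub (continuous_finsetSum _ fun i _ => continuous_const.mul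
      (Complex.continuous_re.comp ?_))
    let φ : (H →L[ℂ] H) →ₗ[ℂ] ℂ :=
      LinearMap.trace ℂ H ∘ₗ LinearMap.mulLeft ℂ (τ i) ∘ₗ ContinuousLinearMap.coeLM ℂ
    exact (LinearMap.continuous_of_finiteDimensional φ).comp (continuous_apply i)
  convert (isCompact_setOf_isPOVM (H := H) M).image hF using 1
  ext e
  constructor
  · rintro ⟨P, hP, rfl⟩
    exact ⟨fun i => LinearMap.toContinuousLinearMap (P i), hP, rfl⟩
  · rintro ⟨P, hP, rfl⟩
    exact ⟨_, hP, rfl⟩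

end Operators

/-! ### Block-diagonal operators and the binary test built from a POVM. -/

section BlockDiagonal

variable {H : Type*} [NormedAddCommGroup H] [InnerProductSpace ℂ H] {M : ℕ}

@[simp]
theorem blockDiag_apply (A : Fin M → (H →ₗ[ℂ] H)) (x : PiLp 2 (fun _ : Fin M => H)) (i : Fin M) :
    blockDiag A x i = A i (x i) := rfl

theorem blockDiag_comp (A B : Fin M → (H →ₗ[ℂ] H)) :
    blockDiag A ∘ₗ blockDiag B = blockDiag fun i => A i ∘ₗ B i := rfl

theorem blockDiag_sub (A B : Fin M → (H →ₗ[ℂ] H)) :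
    blockDiag A - blockDiag B = blockDiag fun i => A i - B i := rfl

theorem blockDiag_smul (c : ℂ) (A : Fin M → (H →ₗ[ℂ] H)) :
    c • blockDiag A = blockDiag fun i => c • A i := rfl

theorem blockDiag_one : blockDiag (fun _ : Fin M => (1 : H →ₗ[ℂ] H)) = 1 := rfl

theorem isPositive_blockDiag {A : Fin M → (H →ₗ[ℂ] H)} (hA : ∀ i, (A i).IsPositive) :
    (blockDiag A).IsPositive := by
  refine ⟨fun x y => ?_, fun x => ?_⟩
  · simp only [PiLp.inner_apply, blockDiag_apply]
    exact Finset.sum_congr rfl fun i _ => (hA i).isSymmetric _ _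
  · simp only [PiLp.inner_apply, blockDiag_apply, map_sum]
    exact Finset.sum_nonneg fun i _ => (hA i).re_inner_nonneg_left _

theorem trace_blockDiag [FiniteDimensional ℂ H] (A : Fin M → (H →ₗ[ℂ] H)) :
    LinearMap.trace ℂ _ (blockDiag A) = ∑ i, LinearMap.trace ℂ H (A i) := by
  let b := stdOrthonormalBasis ℂ H
  rw [LinearMap.trace_eq_sum_inner _ (Pi.orthonormalBasis fun _ : Fin M => b),
    Fintype.sum_sigma]
  refine Finset.sum_congr rfl fun i _ => ?_
  rw [LinearMap.trace_eq_sum_inner _ b]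
  refine Finset.sum_congr rfl fun k _ => ?_
  rw [Pi.orthonormalBasis_apply, PiLp.inner_apply, Finset.sum_eq_single i]
  · simp
  · intro l _ hl
    simp [hl]
  · simp

theorem isPositive_bigT {p : Fin M → ℝ} (hp : ∀ i, 0 ≤ p i) {τ : Fin M → (H →ₗ[ℂ] H)}
    (hτ : ∀ i, IsDensityOperator (τ i)) : (bigT p τ).IsPositive :=
  isPositive_blockDiag fun i => (hτ i).1.smul_of_nonneg (by exact_mod_cast hp i)

theorem IsPOVM.isBinaryTest_blockDiag {P : Fin M → (H →ₗ[ℂ] H)} (hP : IsPOVM P) :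
    IsBinaryTest (blockDiag P) := by
  refine ⟨isPositive_blockDiag hP.1, ?_⟩
  rw [← blockDiag_one, blockDiag_sub]
  exact isPositive_blockDiag hP.isPositive_one_sub

end BlockDiagonal

/-! ### The two bounds relating `alpha` to the average error. -/

section Converse

variable {H : Type*} [NormedAddCommGroup H] [InnerProductSpace ℂ H] [FiniteDimensional ℂ H]
  {M : ℕ}

theorem alpha_le_typeIError {β : ℝ} {ρ₀ ρ₁ T : H →ₗ[ℂ] H} (hρ₀ : ρ₀.IsPositive)
    (hT : IsBinaryTest T) (hβ : typeIIError ρ₁ T ≤ β) : alpha β ρ₀ ρ₁ ≤ typeIError ρ₀ T := by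
  -- The lower bound `1 - tr ρ₀` holds because `tr (ρ₀ (1 - S)) ≥ 0`.
  refine csInf_le ⟨1 - (LinearMap.trace ℂ H ρ₀).re, ?_⟩ ⟨T, hT, hβ, rfl⟩
  rintro _ ⟨S, hS, -, rfl⟩
  have h := re_trace_comp_nonneg hρ₀ hS.2
  rw [LinearMap.comp_sub, map_sub, Complex.sub_re, Module.End.one_eq_id, LinearMap.comp_id] at h
  simp only [typeIError]
  linarith

theorem typeIError_blockDiag (p : Fin M → ℝ) (τ P : Fin M → (H →ₗ[ℂ] H)) :
    typeIError (bigT p τ) (blockDiag P) = avgError p τ P := by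
  simp only [typeIError, avgError, bigT, blockDiag_comp, trace_blockDiag, LinearMap.smul_comp,
    map_smul, smul_eq_mul, Complex.re_sum, Complex.re_ofReal_mul]

/-- All blocks of `bigD M μ` are equal, so only `∑ i, P i = 1` matters. -/
theorem IsPOVM.typeIIError_blockDiag {P : Fin M → (H →ₗ[ℂ] H)} (hP : IsPOVM P) {μ : H →ₗ[ℂ] H}
    (hμ : IsDensityOperator μ) : typeIIError (bigD M μ) (blockDiag P) = 1 / (M : ℝ) := by
  have h : LinearMap.trace ℂ _ (bigD M μ ∘ₗ blockDiag P) = ((1 / (M : ℝ) : ℝ) : ℂ) := by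
    simp only [bigD, blockDiag_comp, trace_blockDiag, LinearMap.smul_comp, map_smul]
    rw [← Finset.smul_sum, ← map_sum]
    simp only [← Module.End.mul_eq_comp]
    rw [← Finset.mul_sum, hP.2, mul_one, hμ.2]
    simp
  rw [typeIIError, h, Complex.ofReal_re]

theorem alpha_le_avgError {p : Fin M → ℝ} (hp : ∀ i, 0 ≤ p i) {τ P : Fin M → (H →ₗ[ℂ] H)}
    (hτ : ∀ i, IsDensityOperator (τ i)) (hP : IsPOVM P) {μ : H →ₗ[ℂ] H}
    (hμ : IsDensityOperator μ) :
    alpha (1 / (M : ℝ)) (bigT p τ) (bigD M μ) ≤ avgError p τ P := by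
  rw [← typeIError_blockDiag]
  exact alpha_le_typeIError (isPositive_bigT hp hτ) hP.isBinaryTest_blockDiag
    (hP.typeIIError_blockDiag hμ).le

/-- If `s • μ` dominates every `p i • τ i`, then every test with type-II error at most `1 / M`
for `bigD M μ` has type-I error at least `1 - s` for `bigT p τ`. -/
theorem one_sub_le_typeIError [NeZero M] {p : Fin M → ℝ} {τ : Fin M → (H →ₗ[ℂ] H)}
    {μ : H →ₗ[ℂ] H} {s : ℝ} (hs : 0 ≤ s) (h : ∀ i, ((s : ℂ) • μ - (p i : ℂ) • τ i).IsPositive)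
    {T : PiLp 2 (fun _ : Fin M => H) →ₗ[ℂ] PiLp 2 (fun _ : Fin M => H)} (hT : IsBinaryTest T)
    (hII : typeIIError (bigD M μ) T ≤ 1 / (M : ℝ)) : 1 - s ≤ typeIError (bigT p τ) T := by
  have hM : (0 : ℝ) < M := by exact_mod_cast Nat.pos_of_ne_zero (NeZero.ne M)
  have e : blockDiag (fun i => (s : ℂ) • μ - (p i : ℂ) • τ i) =
      ((s * M : ℝ) : ℂ) • bigD M μ - bigT p τ := by
    rw [bigD, bigT, blockDiag_smul, blockDiag_sub]
    have hM' : (M : ℂ) ≠ 0 := by exact_mod_cast hM.ne'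
    congr 1
    funext i
    rw [smul_smul]
    push_cast
    rw [mul_assoc, mul_one_div_cancel hM', mul_one]
  -- Pairing `s M • bigD M μ - bigT p τ ≥ 0` with `T` bounds the success by `s M` times the type-II
  -- error.
  have h1 := re_trace_comp_nonneg (isPositive_blockDiag h) hT.1
  rw [e, LinearMap.sub_comp, LinearMap.smul_comp, map_sub, map_smul, smul_eq_mul, Complex.sub_re,
    Complex.re_ofReal_mul] at h1
  have h2 := mul_le_mul_of_nonneg_left hII (mul_nonneg hs hM.le)
  have h3 : s * M * (1 / (M : ℝ)) = s := by
    rw [mul_assoc, mul_one_div_cancel hM.ne', mul_one]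
  simp only [typeIError, typeIIError] at *
  linarith

theorem le_alpha [NeZero M] {p : Fin M → ℝ} {τ : Fin M → (H →ₗ[ℂ] H)}
    {μ : H →ₗ[ℂ] H} {s : ℝ} (hs : 0 ≤ s) (h : ∀ i, ((s : ℂ) • μ - (p i : ℂ) • τ i).IsPositive) :
    1 - s ≤ alpha (1 / (M : ℝ)) (bigT p τ) (bigD M μ) := by
  refine le_csInf ⟨_, 0, isBinaryTest_zero, by simp [typeIIError], rfl⟩ ?_
  rintro _ ⟨T, hT, hII, rfl⟩
  exact one_sub_le_typeIError hs h hT hII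

theorem exists_density_le_alpha [NeZero M] {p : Fin M → ℝ} (hp : ∀ i, 0 ≤ p i)
    (hp1 : ∑ i, p i = 1) {τ P : Fin M → (H →ₗ[ℂ] H)} (hτ : ∀ i, IsDensityOperator (τ i))
    (hP : IsPOVM P) (hopt : ∀ Q, IsPOVM Q → avgError p τ P ≤ avgError p τ Q) :
    ∃ μ : H →ₗ[ℂ] H, IsDensityOperator μ ∧
      avgError p τ P ≤ alpha (1 / (M : ℝ)) (bigT p τ) (bigD M μ) := by
  have hpos : ∀ i, ((p i : ℂ) • τ i).IsPositive := fun i =>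
    (hτ i).1.smul_of_nonneg (by exact_mod_cast hp i)
  have hsum : ∀ Q : Fin M → (H →ₗ[ℂ] H),
      ∑ i, (LinearMap.trace ℂ H (((p i : ℂ) • τ i) * Q i)).re = 1 - avgError p τ Q := fun Q => by
    simp only [avgError, smul_mul_assoc, map_smul, smul_eq_mul, Complex.re_ofReal_mul,
      Module.End.mul_eq_comp, sub_sub_cancel]
  obtain ⟨Λ, hΛ, htr⟩ := exists_dominating_operator (A := fun i => (p i : ℂ) • τ i) hP hpos
    fun Q hQ => by
      rw [hsum, hsum]
      linarith [hopt Q hQ]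
  rw [hsum] at htr
  set s := 1 - avgError p τ P with hs
  have hΛp : Λ.IsPositive := by
    have := (hΛ 0).add (hpos 0)
    rwa [sub_add_cancel] at this
  -- `htr` fixes only the real part; positivity of `Λ` makes the imaginary part vanish.
  have htrace : LinearMap.trace ℂ H Λ = (s : ℂ) := by
    have h0 := Complex.nonneg_iff.1 hΛp.trace_nonneg
    exact Complex.ext (by simpa using htr) (by simpa using h0.2.symm)
  have hps : ∀ i, p i ≤ s := fun i => by
    have h1 := (Complex.nonneg_iff.1 (hΛ i).trace_nonneg).1
    rw [map_sub, map_smul, (hτ i).2, htrace] at h1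
    simpa using h1
  -- Some `p i` is positive because they sum to 1, so `Λ` can be normalised.
  have hs0 : 0 < s := by
    obtain ⟨i, -, hi⟩ : ∃ i ∈ Finset.univ, 0 < p i := by
      by_contra! hcon
      have := Finset.sum_nonpos hcon
      linarith
    exact hi.trans_le (hps i)
  have hsc : (s : ℂ) ≠ 0 := by exact_mod_cast hs0.ne'
  refine ⟨((s⁻¹ : ℝ) : ℂ) • Λ, ⟨hΛp.smul_of_nonneg ?_, ?_⟩, ?_⟩
  · exact_mod_cast (inv_pos.2 hs0).le
  · rw [map_smul, htrace, smul_eq_mul, Complex.ofReal_inv, inv_mul_cancel₀ hsc]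
  · rw [show avgError p τ P = 1 - s by rw [hs]; ring]
    refine le_alpha hs0.le fun i => ?_
    rw [smul_smul, Complex.ofReal_inv, mul_inv_cancel₀ hsc, one_smul]
    exact hΛ i

end Converse

end QHT

theorem theorem1 {H : Type*} [NormedAddCommGroup H] [InnerProductSpace ℂ H]
    [FiniteDimensional ℂ H] (M : ℕ) (p : Fin M → ℝ) (hp : ∀ i, 0 ≤ p i) (hp1 : ∑ i, p i = 1)
    (τ : Fin M → (H →ₗ[ℂ] H)) (hτ : ∀ i, QHT.IsDensityOperator (τ i)) :
    IsLeast (QHT.achievableErrors p τ) (QHT.minError p τ) ∧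
    IsGreatest
      {a : ℝ | ∃ μ : H →ₗ[ℂ] H, QHT.IsDensityOperator μ ∧
        QHT.alpha (1 / (M : ℝ)) (QHT.bigT p τ) (QHT.bigD M μ) = a}
      (QHT.minError p τ) := by
  have : NeZero M := ⟨by rintro rfl; simp at hp1⟩
  have hleast : IsLeast (QHT.achievableErrors p τ) (QHT.minError p τ) :=
    (QHT.isCompact_achievableErrors p τ).isLeast_sInf (QHT.achievableErrors_nonempty p τ)
  refine ⟨hleast, ?_⟩
  have hub : ∀ μ : H →ₗ[ℂ] H, QHT.IsDensityOperator μ →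
      QHT.alpha (1 / (M : ℝ)) (QHT.bigT p τ) (QHT.bigD M μ) ≤ QHT.minError p τ := by
    intro μ hμ
    obtain ⟨P, hP, hPe⟩ := hleast.1
    rw [← hPe]
    exact QHT.alpha_le_avgError hp hτ hP hμ
  refine ⟨?_, ?_⟩
  · obtain ⟨P, hP, hPe⟩ := hleast.1
    obtain ⟨μ, hμ, hle⟩ := QHT.exists_density_le_alpha hp hp1 hτ hP fun Q hQ => by
      rw [hPe]
      exact hleast.2 ⟨Q, hQ, rfl⟩
    exact ⟨μ, hμ, le_antisymm (hub μ hμ) (hPe ▸ hle)⟩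
  · rintro _ ⟨μ, hμ, rfl⟩
    exact hub μ hμ
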